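/- Let $G$ be an infinite discrete abelian group acting by homeomorphisms on a compact metric space $X$, and let $\mathcal F=(F_n)_{n\in D}$ be a Følner net in $G$, that is, a net of nonempty finite subsets of $G$, indexed by a (nonempty) directed set $D$, with $\lim_{n\in D}|gF_n\triangle F_n|/|F_n|=0$ for every $g\in G$. For $A\subseteq G$ put $$\bar d_{\mathcal F}(A)=\sup\Big\{\alpha : \forall m\in D\ \exists n\ge m,\ \tfrac{|A\cap F_n|}{|F_n|}\ge\alpha\Big\},\qquad \underline d_{\mathcal F}(A)=\sup\Big\{\alpha : \exists m\in D\ \forall n\ge m,\ \tfrac{|A\cap F_n|}{|F_n|}\ge\alpha\Big\},$$ and say that $A$ has density $a$ if $\bar d_{\mathcal F}(A)=\underline d_{\mathcal F}(A)=a$. For $x\in X$, a closed set $C\subseteq X$ is an $\mathcal F$-center of attraction of $x$ if for every $\epsilon>0$ the set $\{g\in G: gx\in B_\epsilon(C)\}$ has density $1$, where $B_\epsilon(C)$ is the open $\epsilon$-neighbourhood of $C$; the minimal $\mathcal F$-center of attraction $C_{\mathcal F}(x)$ is the $\mathcal F$-center of attraction of $x$ that has no proper subset which is also an $\mathcal F$-center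 of attraction of $x$. A set $\Lambda\subseteq X$ is S-generic if $\Lambda=C_{\mathcal F}(y)$ for some $y\in\Lambda$ (such a set is automatically $G$-invariant). A nonempty set $\Lambda\subseteq X$ is minimal if $\overline{Gz}=\Lambda$ for every $z\in\Lambda$. A point $z\in X$ is almost periodic if for every neighbourhood $U$ of $z$ the set $N(z,U)=\{g\in G: gz\in U\}$ is syndetic, i.e. $S^{-1}N(z,U)=G$ for some finite $S\subseteq G$. **Theorem 1.6.** Let $x\in X$. Suppose that $C_{\mathcal F}(x)$ is S-generic, that it is not minimal, and that the almost periodic points lying in $C_{\mathcal F}(x)$ are dense in $C_{\mathcal F}(x)$. Then there is an infinite countable set $K\subseteq C_{\mathcal F}(x)$ such that for all $k\ge 2$, all distinct points $x_1,\dots,x_k\in K$, every $\hat x\in C_{\mathcal F}(x)$, every neighbourhood $U$ of $\hat x$ in $X$ and all neighbourhoods $U_i$ of $x_i$ in $X$ $(1\le i\le k)$, there are $y_1,\dots,y_k\in U$ and a single $g\in G$ with $gy_i\in U_i$ for every $1\le i\le k$. -/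

import Mathlib

open scoped Pointwise symmDiff Topology

namespace MinimalCenter

variable {G D X : Type*}

/-- A left Følner net in the discrete group `G`: a net `F` of nonempty finite subsets of `G`,
indexed by a directed set `D`, with `|g F_n ∆ F_n| / |F_n| → 0` for every `g`. -/
structure IsFolnerNet [Group G] [Preorder D] (F : D → Finset G) : Prop where
  nonempty : ∀ n, (F n).Nonempty
  tendsto : ∀ g : G, Filter.Tendsto
    (fun n => (((g • (F n : Set G)) ∆ (F n : Set G)).ncard : ℝ) / ((F n).card : ℝ))
    Filter.atTop (𝓝 0)

/-- The proportion `|A ∩ F_n| / |F_n|`. -/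
noncomputable def ratio (F : D → Finset G) (A : Set G) (n : D) : ℝ :=
  ((A ∩ (F n : Set G)).ncard : ℝ) / ((F n).card : ℝ)

/-- Upper density of `A` relative to the net `F`. The set on the right contains `0` and is
bounded above by `1`. -/
noncomputable def upperDensity [Preorder D] (F : D → Finset G) (A : Set G) : ℝ :=
  sSup {α : ℝ | ∀ m : D, ∃ n, m ≤ n ∧ α ≤ ratio F A n}

/-- Lower density of `A` relative to the net `F`. The set on the right contains `0` and is
bounded above by `1`. -/
noncomputable def lowerDensity [Preorder D] (F : D → Finset G) (A : Set G) : ℝ :=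
  sSup {α : ℝ | ∃ m : D, ∀ n, m ≤ n → α ≤ ratio F A n}

/-- `A` has density `a` relative to `F`: upper and lower density agree and equal `a`. -/
def HasDensity [Preorder D] (F : D → Finset G) (A : Set G) (a : ℝ) : Prop :=
  upperDensity F A = a ∧ lowerDensity F A = a

/-- The set `N(x, E)` of all `g` with `g x ∈ E`. -/
def visits (G : Type*) {X : Type*} [SMul G X] (x : X) (E : Set X) : Set G :=
  {g : G | g • x ∈ E}

/-- `C` is an `F`-center of attraction of `x`: it is closed and the orbit of `x` sojourns in each
`ε`-neighbourhood of `C` with probability one. -/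
def IsCenterOfAttraction [Preorder D] [MetricSpace X] [SMul G X]
    (F : D → Finset G) (x : X) (C : Set X) : Prop :=
  IsClosed C ∧ ∀ ε : ℝ, 0 < ε → HasDensity F (visits G x (Metric.thickening ε C)) 1

/-- `C` is the minimal `F`-center of attraction `C_F(x)` of `x`: an `F`-center of attraction
of `x` no proper subset of which is an `F`-center of attraction of `x`. -/
def IsMinimalCenter [Preorder D] [MetricSpace X] [SMul G X]
    (F : D → Finset G) (x : X) (C : Set X) : Prop :=
  IsCenterOfAttraction F x C ∧ ∀ C' : Set X, C' ⊂ C → ¬ IsCenterOfAttraction F x C'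

/-- `Λ` is S-generic: `Λ = C_F(y)` for some point `y` of `Λ`. (Minimal centers of attraction
relative to a Følner net are automatically invariant, so invariance is not demanded here.) -/
def IsSGeneric [Preorder D] [MetricSpace X] [SMul G X]
    (F : D → Finset G) (Λ : Set X) : Prop :=
  ∃ y ∈ Λ, IsMinimalCenter F y Λ

/-- `Λ` is a minimal subset of the `G`-system: it is nonempty and is the orbit closure of each
of its points (so it is closed and invariant). -/
def IsMinimalSubset (G : Type*) {X : Type*} [TopologicalSpace X] [Group G] [MulAction G X]
    (Λ : Set X) : Prop :=
  Λ.Nonempty ∧ ∀ z ∈ Λ, closure (MulAction.orbit G z) = Λ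

/-- `P ⊆ G` is syndetic: `S⁻¹ P = G` for some finite `S ⊆ G`. -/
def IsSyndetic [Group G] (P : Set G) : Prop :=
  ∃ S : Finset G, (S : Set G)⁻¹ * P = Set.univ

/-- `z` is almost periodic: the return-time set `N(z, U)` is syndetic for every neighbourhood
`U` of `z`. -/
def IsAlmostPeriodic (G : Type*) {X : Type*} [TopologicalSpace X] [Group G] [MulAction G X]
    (z : X) : Prop :=
  ∀ U ∈ 𝓝 z, IsSyndetic (visits G z U)

end MinimalCenter

/-! The set `C` is a topologically transitive system: centers of attraction are stable under
intersection and, because `F` is a Følner net, under translation, so `C` is invariant and is the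
orbit closure of the point `y ∈ C` with `C = C_F(y)` (`IsMinimalCenter.closure_orbit_eq`).

The orbit closure of an almost periodic point is minimal. As the almost periodic points are dense
in `C` and `C` is not minimal, `C` contains infinitely many minimal sets `M 0, M 1, …`
(`infinite_minimalSubsets`).

The heart of the argument is `exists_jointly_syndetic`: every neighbourhood `W` of `y` contains
points `w 0, …, w (k - 1)` that visit the `ε`-neighbourhoods of `M 0, …, M (k - 1)`
*simultaneously*, along a syndetic set of times. In the inductive step one has a finite set `S`
witnessing syndeticity for the first `k` points. The orbit of `y` comes so close to the invariant
set `M k` that all of `S` keeps it in the `ε`-neighbourhood; this is an open condition, hence it is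
shared by an almost periodic point of `W`, which repeats the behaviour syndetically. The stay
near `M k` is then long enough to meet one of the joint visiting times of the first `k` points.

Letting `W`, `ε` shrink and `k` grow, compactness of `∏ M n` yields limit points `m n ∈ M n`, and
`K` is the set of these. They are distinct since distinct minimal sets are disjoint. Passing from
neighbourhoods of `y` to neighbourhoods of an arbitrary point of `C = closure (G y)` only requires
translating by a group element. -/

namespace MinimalCenter

open Filter Set Metric

variable {G D X : Type*}

/-! ### Sets of density one -/

section Density

lemma ratio_mono {F : D → Finset G} {A B : Set G} (h : A ⊆ B) (n : D) :
    ratio F A n ≤ ratio F B n := by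
  unfold ratio
  gcongr
  exact (F n).finite_toSet.inter_of_right B

lemma ratio_nonneg (F : D → Finset G) (A : Set G) (n : D) : 0 ≤ ratio F A n := by
  unfold ratio
  positivity

lemma ratio_le_one (F : D → Finset G) (A : Set G) (n : D) : ratio F A n ≤ 1 := by
  unfold ratio
  refine div_le_one_of_le₀ ?_ (by positivity)
  have := ncard_le_ncard (inter_subset_right : A ∩ (F n : Set G) ⊆ F n) (F n).finite_toSet
  rw [ncard_coe_finset] at this
  exact_mod_cast this

lemma ratio_univ {F : D → Finset G} {n : D} (h : (F n).Nonempty) : ratio F univ n = 1 := by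
  have : ((F n).card : ℝ) ≠ 0 := by exact_mod_cast h.card_pos.ne'
  simp [ratio, ncard_coe_finset, this]

lemma ratio_add_ratio_le {F : D → Finset G} {n : D} (h : (F n).Nonempty) (A B : Set G) :
    ratio F A n + ratio F B n ≤ 1 + ratio F (A ∩ B) n := by
  have hpos : (0 : ℝ) < (F n).card := by exact_mod_cast h.card_pos
  have h1 := ncard_union_add_ncard_inter (A ∩ (F n : Set G)) (B ∩ (F n : Set G))
    ((F n).finite_toSet.inter_of_right A) ((F n).finite_toSet.inter_of_right B)
  have h2 := ncard_le_ncard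
    (union_subset inter_subset_right inter_subset_right :
      (A ∩ (F n : Set G)) ∪ (B ∩ (F n : Set G)) ⊆ F n) (F n).finite_toSet
  rw [ncard_coe_finset] at h2
  rw [← inter_inter_distrib_right] at h1
  have h3 : (((A ∩ (F n : Set G)).ncard : ℝ) + (B ∩ (F n : Set G)).ncard)
      ≤ (F n).card + ((A ∩ B) ∩ (F n : Set G)).ncard := by
    exact_mod_cast (by omega)
  unfold ratio
  rw [← add_div, ← div_self hpos.ne', ← add_div]
  gcongr

lemma ratio_le_ratio_smul_add [Group G] (F : D → Finset G) (A : Set G) (g : G) (n : D) :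
    ratio F A n ≤ ratio F (g • A) n +
      (((g • (F n : Set G)) ∆ (F n : Set G)).ncard : ℝ) / ((F n).card : ℝ) := by
  unfold ratio
  rw [← add_div]
  have hfin : (g • (F n : Set G)).Finite := (F n).finite_toSet.smul_set
  have h1 : (A ∩ (F n : Set G)).ncard = ((g • A) ∩ (g • (F n : Set G))).ncard := by
    rw [← smul_set_inter, ncard_smul_set]
  have h2 : (g • A) ∩ (g • (F n : Set G)) ⊆
      ((g • A) ∩ (F n : Set G)) ∪ ((g • (F n : Set G)) ∆ (F n : Set G)) := by
    rintro a ⟨ha, hb⟩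
    by_cases hc : a ∈ (F n : Set G)
    · exact Or.inl ⟨ha, hc⟩
    · exact Or.inr (Or.inl ⟨hb, hc⟩)
  have hfin' : ((g • (F n : Set G)) ∆ (F n : Set G)).Finite :=
    hfin.symmDiff (F n).finite_toSet
  have h3 := (ncard_le_ncard h2 (((F n).finite_toSet.inter_of_right _).union hfin')).trans
    (ncard_union_le _ _)
  rw [← h1] at h3
  gcongr
  exact_mod_cast h3

variable [Preorder D] [IsDirectedOrder D] [Nonempty D]

lemma hasDensity_one_iff (F : D → Finset G) (A : Set G) :
    HasDensity F A 1 ↔ ∀ ε : ℝ, 0 < ε → ∀ᶠ n in atTop, 1 - ε ≤ ratio F A n := by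
  have bddU : ∀ α ∈ {α : ℝ | ∀ m : D, ∃ n, m ≤ n ∧ α ≤ ratio F A n}, α ≤ 1 := by
    intro α hα
    obtain ⟨n, -, hn⟩ := hα (Classical.arbitrary D)
    exact hn.trans (ratio_le_one F A n)
  have bddL : ∀ α ∈ {α : ℝ | ∃ m : D, ∀ n, m ≤ n → α ≤ ratio F A n}, α ≤ 1 := by
    rintro α ⟨m, hm⟩
    exact (hm m le_rfl).trans (ratio_le_one F A m)
  constructor
  · rintro ⟨-, hL⟩ ε hε
    have hlt : 1 - ε < sSup {α : ℝ | ∃ m : D, ∀ n, m ≤ n → α ≤ ratio F A n} := by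
      unfold lowerDensity at hL
      rw [hL]
      linarith
    have hne : {α : ℝ | ∃ m : D, ∀ n, m ≤ n → α ≤ ratio F A n}.Nonempty :=
      ⟨0, Classical.arbitrary D, fun n _ => ratio_nonneg F A n⟩
    obtain ⟨α, ⟨m, hm⟩, hα⟩ := exists_lt_of_lt_csSup hne hlt
    filter_upwards [eventually_ge_atTop m] with n hn
    exact hα.le.trans (hm n hn)
  · intro h
    have hmem : ∀ ε : ℝ, 0 < ε → ∃ m : D, ∀ n, m ≤ n → 1 - ε ≤ ratio F A n := fun ε hε =>
      eventually_atTop.1 (h ε hε)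
    refine ⟨csSup_eq_of_forall_le_of_forall_lt_exists_gt ?_ bddU ?_,
      csSup_eq_of_forall_le_of_forall_lt_exists_gt ?_ bddL ?_⟩
    · exact ⟨0, fun m => ⟨m, le_rfl, ratio_nonneg F A m⟩⟩
    · intro w hw
      obtain ⟨m, hm⟩ := hmem ((1 - w) / 2) (by linarith)
      refine ⟨1 - (1 - w) / 2, fun m' => ?_, by linarith⟩
      obtain ⟨n, hn, hn'⟩ := exists_ge_ge m m'
      exact ⟨n, hn', hm n hn⟩
    · exact ⟨0, Classical.arbitrary D, fun n _ => ratio_nonneg F A n⟩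
    · intro w hw
      exact ⟨1 - (1 - w) / 2, hmem _ (by linarith), by linarith⟩

lemma HasDensity.mono {F : D → Finset G} {A B : Set G} (hA : HasDensity F A 1) (h : A ⊆ B) :
    HasDensity F B 1 := by
  rw [hasDensity_one_iff] at hA ⊢
  intro ε hε
  filter_upwards [hA ε hε] with n hn
  exact hn.trans (ratio_mono h n)

lemma HasDensity.inter {F : D → Finset G} (hF : ∀ n, (F n).Nonempty) {A B : Set G}
    (hA : HasDensity F A 1) (hB : HasDensity F B 1) : HasDensity F (A ∩ B) 1 := by
  rw [hasDensity_one_iff] at hA hB ⊢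
  intro ε hε
  filter_upwards [hA (ε / 2) (by linarith), hB (ε / 2) (by linarith)] with n h1 h2
  have := ratio_add_ratio_le (hF n) A B
  linarith

lemma HasDensity.smul [Group G] {F : D → Finset G} (hF : IsFolnerNet F) {A : Set G}
    (hA : HasDensity F A 1) (g : G) : HasDensity F (g • A) 1 := by
  rw [hasDensity_one_iff] at hA ⊢
  intro ε hε
  filter_upwards [hA (ε / 2) (by linarith),
    (hF.tendsto g).eventually_le_const (half_pos hε)] with n h1 h2
  have := ratio_le_ratio_smul_add F A g n
  linarith

lemma hasDensity_univ {F : D → Finset G} (hF : ∀ n, (F n).Nonempty) :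
    HasDensity F univ 1 := by
  rw [hasDensity_one_iff]
  intro ε hε
  filter_upwards with n
  rw [ratio_univ (hF n)]
  linarith

end Density

/-! ### Centers of attraction -/

section Center

lemma exists_thickening_inter_subset [MetricSpace X] [CompactSpace X] {C C' : Set X}
    (hC : IsClosed C) (hC' : IsClosed C') {ε : ℝ} (hε : 0 < ε) :
    ∃ δ : ℝ, 0 < δ ∧ thickening δ C ∩ thickening δ C' ⊆ thickening ε (C ∩ C') := by
  have hK : IsCompact (thickening ε (C ∩ C'))ᶜ := isOpen_thickening.isClosed_compl.isCompact
  rcases (thickening ε (C ∩ C'))ᶜ.eq_empty_or_nonempty with hemp | hne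
  · exact ⟨1, one_pos, by rw [compl_empty_iff.1 hemp]; exact subset_univ _⟩
  -- `infEDist` rather than `infDist`: `infDist` takes the junk value `0` on the empty set.
  obtain ⟨p, hp, hmin⟩ := hK.exists_isMinOn hne
    (f := fun z => max (infEDist z C) (infEDist z C'))
    (continuous_infEDist.max continuous_infEDist).continuousOn
  have hpos : 0 < max (infEDist p C) (infEDist p C') := by
    rw [pos_iff_ne_zero]
    intro h0
    have h1 : infEDist p C = 0 := le_antisymm ((le_max_left _ _).trans h0.le) bot_le
    have h2 : infEDist p C' = 0 := le_antisymm ((le_max_right _ _).trans h0.le) bot_le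
    exact hp (self_subset_thickening hε _
      ⟨(mem_iff_infEDist_zero_of_closed hC).2 h1, (mem_iff_infEDist_zero_of_closed hC').2 h2⟩)
  obtain ⟨δ, hδ, hδ'⟩ := ENNReal.lt_iff_exists_nnreal_btwn.1 hpos
  refine ⟨δ, by exact_mod_cast hδ, ?_⟩
  rintro z ⟨hz, hz'⟩
  by_contra hcon
  have h1 : max (infEDist p C) (infEDist p C') ≤ max (infEDist z C) (infEDist z C') := hmin hcon
  rw [mem_thickening_iff_infEDist_lt, ENNReal.ofReal_coe_nnreal] at hz hz'
  exact absurd (hδ'.trans_le h1) (max_lt hz hz').not_gt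

lemma exists_smul_thickening_subset [MetricSpace X] [CompactSpace X] [Group G] [MulAction G X]
    [ContinuousConstSMul G X] (g : G) (C : Set X) {ε : ℝ} (hε : 0 < ε) :
    ∃ δ : ℝ, 0 < δ ∧ ∀ z ∈ thickening δ C, g • z ∈ thickening ε (g • C) := by
  have huc := CompactSpace.uniformContinuous_of_continuous (continuous_const_smul g : Continuous
    fun z : X => g • z)
  obtain ⟨δ, hδ, h⟩ := Metric.uniformContinuous_iff.1 huc ε hε
  refine ⟨δ, hδ, fun z hz => ?_⟩
  obtain ⟨c, hc, hzc⟩ := mem_thickening_iff.1 hz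
  exact mem_thickening_iff.2 ⟨g • c, smul_mem_smul_set hc, h hzc⟩

variable [Preorder D] [IsDirectedOrder D] [Nonempty D] [MetricSpace X] {F : D → Finset G} {x : X} {C C' : Set X}

lemma isCenterOfAttraction_closure_orbit [Group G] [MulAction G X]
    (hF : ∀ n, (F n).Nonempty) :
    IsCenterOfAttraction F x (closure (MulAction.orbit G x)) :=
  ⟨isClosed_closure, fun _ hε => (hasDensity_univ hF).mono fun g _ =>
    self_subset_thickening hε _ (subset_closure (MulAction.mem_orbit x g))⟩

variable [CompactSpace X]

lemma IsCenterOfAttraction.inter [SMul G X] (hF : ∀ n, (F n).Nonempty)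
    (h : IsCenterOfAttraction F x C) (h' : IsCenterOfAttraction F x C') :
    IsCenterOfAttraction F x (C ∩ C') := by
  refine ⟨h.1.inter h'.1, fun ε hε => ?_⟩
  obtain ⟨δ, hδ, hsub⟩ := exists_thickening_inter_subset h.1 h'.1 hε
  exact ((h.2 δ hδ).inter hF (h'.2 δ hδ)).mono fun g hg => hsub hg

lemma IsCenterOfAttraction.smul [Group G] [MulAction G X] [ContinuousConstSMul G X]
    (hF : IsFolnerNet F) (h : IsCenterOfAttraction F x C) (g : G) :
    IsCenterOfAttraction F x (g • C) := by
  refine ⟨h.1.smul g, fun ε hε => ?_⟩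
  obtain ⟨δ, hδ, hsub⟩ := exists_smul_thickening_subset g C hε
  refine ((h.2 δ hδ).smul hF g).mono ?_
  rintro _ ⟨a, ha, rfl⟩
  change (g * a) • x ∈ thickening ε (g • C)
  rw [mul_smul]
  exact hsub _ ha

lemma IsMinimalCenter.subset [SMul G X] (hF : ∀ n, (F n).Nonempty)
    (h : IsMinimalCenter F x C) (h' : IsCenterOfAttraction F x C') : C ⊆ C' := by
  by_contra hcon
  exact h.2 (C ∩ C') (inter_ssubset_left_iff.2 hcon) (h.1.inter hF h')

lemma IsMinimalCenter.smul_mem [Group G] [MulAction G X] [ContinuousConstSMul G X]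
    (hF : IsFolnerNet F) (h : IsMinimalCenter F x C) (g : G) {z : X} (hz : z ∈ C) :
    g • z ∈ C := by
  simpa [mem_smul_set_iff_inv_smul_mem] using h.subset hF.nonempty (h.1.smul hF g⁻¹) hz

lemma IsMinimalCenter.closure_orbit_eq [Group G] [MulAction G X] [ContinuousConstSMul G X]
    (hF : IsFolnerNet F) (h : IsMinimalCenter F x C) (hx : x ∈ C) :
    closure (MulAction.orbit G x) = C := by
  refine Subset.antisymm (closure_minimal ?_ h.1.1)
    (h.subset hF.nonempty (isCenterOfAttraction_closure_orbit hF.nonempty))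
  rintro _ ⟨g, rfl⟩
  exact h.smul_mem hF g hx

end Center

/-! ### Almost periodic points and minimal sets -/

section Minimal

variable [Group G] [MulAction G X]

lemma IsSyndetic.exists_finset {P : Set G} (h : IsSyndetic P) :
    ∃ S : Finset G, ∀ g, ∃ s ∈ S, s * g ∈ P := by
  obtain ⟨S, hS⟩ := h
  refine ⟨S, fun g => ?_⟩
  obtain ⟨a, ha, b, hb, hab⟩ := mem_mul.1 (hS ▸ mem_univ g)
  exact ⟨a⁻¹, ha, by simpa [← hab] using hb⟩

lemma smul_mem_closure_orbit [TopologicalSpace X] [ContinuousConstSMul G X] (g : G) {z w : X}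
    (hw : w ∈ closure (MulAction.orbit G z)) : g • w ∈ closure (MulAction.orbit G z) :=
  map_mem_closure (continuous_const_smul g) hw fun _ hv =>
    MulAction.mem_orbit_of_mem_orbit g hv

lemma closure_orbit_subset [TopologicalSpace X] [ContinuousConstSMul G X] {z w : X}
    (hw : w ∈ closure (MulAction.orbit G z)) :
    closure (MulAction.orbit G w) ⊆ closure (MulAction.orbit G z) := by
  refine closure_minimal ?_ isClosed_closure
  rintro _ ⟨g, rfl⟩
  exact smul_mem_closure_orbit g hw

lemma IsMinimalSubset.isClosed [TopologicalSpace X] {M : Set X} (h : IsMinimalSubset G M) :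
    IsClosed M := by
  obtain ⟨z, hz⟩ := h.1
  exact h.2 z hz ▸ isClosed_closure

lemma IsMinimalSubset.smul_mem [TopologicalSpace X] {M : Set X} (h : IsMinimalSubset G M)
    (g : G) {z : X} (hz : z ∈ M) : g • z ∈ M := by
  rw [← h.2 z hz]
  exact subset_closure (MulAction.mem_orbit z g)

lemma IsAlmostPeriodic.isMinimalSubset_closure_orbit [TopologicalSpace X] [RegularSpace X]
    [ContinuousConstSMul G X] {z : X} (hz : IsAlmostPeriodic G z) :
    IsMinimalSubset G (closure (MulAction.orbit G z)) := by
  refine ⟨⟨z, subset_closure (MulAction.mem_orbit_self z)⟩, fun w hw =>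
    (closure_orbit_subset hw).antisymm (closure_orbit_subset ?_)⟩
  rw [mem_closure_iff_nhds]
  intro U hU
  obtain ⟨V, hV, hVc, hVU⟩ := exists_mem_nhds_isClosed_subset hU
  obtain ⟨S, hS⟩ := (hz V hV).exists_finset
  -- The orbit of `z`, hence its closure, is covered by finitely many translates of `V`.
  have hcov : closure (MulAction.orbit G z) ⊆ ⋃ s ∈ S, (fun v => s • v) ⁻¹' V := by
    refine closure_minimal ?_
      (S.finite_toSet.isClosed_biUnion fun s _ => hVc.preimage (continuous_const_smul s))
    rintro _ ⟨g, rfl⟩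
    obtain ⟨s, hs, hsg⟩ := hS g
    exact mem_biUnion hs (by simpa [visits, mul_smul] using hsg)
  obtain ⟨s, -, hs⟩ := mem_iUnion₂.1 (hcov hw)
  exact ⟨s • w, hVU hs, MulAction.mem_orbit w s⟩

/-- A transitive system with dense almost periodic points that is not minimal has infinitely many
minimal sets: the union of finitely many would be closed, so it would contain the transitive
point. -/
lemma infinite_minimalSubsets [TopologicalSpace X] [RegularSpace X] [ContinuousConstSMul G X]
    {C : Set X} {y : X} (hy : closure (MulAction.orbit G y) = C)
    (hmin : ¬ IsMinimalSubset G C)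
    (hap : C ⊆ closure {z : X | z ∈ C ∧ IsAlmostPeriodic G z}) :
    {M : Set X | M ⊆ C ∧ IsMinimalSubset G M}.Infinite := by
  intro hfin
  have hyC : y ∈ C := hy ▸ subset_closure (MulAction.mem_orbit_self y)
  have hcov : closure {z : X | z ∈ C ∧ IsAlmostPeriodic G z} ⊆
      ⋃ M ∈ {M : Set X | M ⊆ C ∧ IsMinimalSubset G M}, M := by
    refine closure_minimal ?_ (hfin.isClosed_biUnion fun M hM => hM.2.isClosed)
    rintro z ⟨hzC, hz⟩
    refine mem_biUnion (x := closure (MulAction.orbit G z))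
      ⟨?_, hz.isMinimalSubset_closure_orbit⟩ (subset_closure (MulAction.mem_orbit_self z))
    rw [← hy] at hzC ⊢
    exact closure_orbit_subset hzC
  obtain ⟨M, ⟨-, hM⟩, hyM⟩ := mem_iUnion₂.1 (hcov (hap hyC))
  exact hmin (hy ▸ (hM.2 y hyM).symm ▸ hM)

end Minimal

/-! ### Joint visits to minimal sets -/

section Joint

variable [Group G] [MetricSpace X] [MulAction G X] [ContinuousConstSMul G X]

/-- Points `w i` near the transitive point `y` whose orbits are close to the respective minimal
sets `M i`, for all `i < k`, at the *same* syndetically many times. -/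
lemma exists_jointly_syndetic {C : Set X} {y : X} (hy : closure (MulAction.orbit G y) = C)
    (hap : C ⊆ closure {z : X | z ∈ C ∧ IsAlmostPeriodic G z})
    {M : ℕ → Set X} (hMC : ∀ n, M n ⊆ C) (hM : ∀ n, IsMinimalSubset G (M n))
    {W : Set X} (hW : W ∈ 𝓝 y) {ε : ℝ} (hε : 0 < ε) (k : ℕ) :
    ∃ (S : Finset G) (w : ℕ → X), (∀ i < k, w i ∈ W) ∧
      ∀ g : G, ∃ s ∈ S, ∀ i < k, (s * g) • w i ∈ thickening ε (M i) := by
  classical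
  induction k with
  | zero => exact ⟨{1}, fun _ => y, by simp, by simp⟩
  | succ k ih =>
    obtain ⟨S, w, hw, hS⟩ := ih
    set V : Set X := ⋂ s ∈ S, (fun v => s • v) ⁻¹' thickening ε (M k) with hV
    have hVo : IsOpen V := isOpen_biInter_finset fun s _ =>
      isOpen_thickening.preimage (continuous_const_smul s)
    obtain ⟨m, hm⟩ := (hM k).1
    have hmV : m ∈ V := mem_iInter₂.2 fun s _ =>
      self_subset_thickening hε _ ((hM k).smul_mem s hm)
    have hmy : m ∈ closure (MulAction.orbit G y) := hy ▸ hMC k hm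
    obtain ⟨_, hgV, g₀, rfl⟩ := mem_closure_iff.1 hmy V hVo hmV
    have hnhds : W ∩ (fun v => g₀ • v) ⁻¹' V ∈ 𝓝 y :=
      inter_mem hW ((hVo.preimage (continuous_const_smul g₀)).mem_nhds hgV)
    have hyC : y ∈ C := hy ▸ subset_closure (MulAction.mem_orbit_self y)
    obtain ⟨z, hz, -, hzap⟩ := mem_closure_iff_nhds.1 (hap hyC) _ (interior_mem_nhds.2 hnhds)
    obtain ⟨T, hT⟩ := (hzap _ (isOpen_interior.mem_nhds hz)).exists_finset
    refine ⟨(S ×ˢ T).image fun p => p.1 * g₀ * p.2, Function.update w k z, ?_, ?_⟩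
    · intro i hi
      rcases Nat.lt_succ_iff_lt_or_eq.1 hi with h | rfl
      · rw [Function.update_of_ne h.ne]
        exact hw i h
      · rw [Function.update_self]
        exact (interior_subset hz).1
    · intro g
      obtain ⟨t, ht, htg⟩ := hT g
      obtain ⟨s, hs, hsg⟩ := hS (g₀ * t * g)
      refine ⟨s * g₀ * t, Finset.mem_image.2 ⟨(s, t), Finset.mk_mem_product hs ht, rfl⟩, ?_⟩
      intro i hi
      rcases Nat.lt_succ_iff_lt_or_eq.1 hi with h | rfl
      · rw [Function.update_of_ne h.ne]
        simpa only [mul_assoc] using hsg i h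
      · rw [Function.update_self]
        have h1 : g₀ • (t * g) • z ∈ V := (interior_subset htg).2
        have h2 : s • g₀ • (t * g) • z ∈ thickening ε (M i) := mem_iInter₂.1 h1 s hs
        simpa only [mul_smul] using h2

/-- Limit form of `exists_jointly_syndetic`: fixed points `m n ∈ M n` such that any finitely many
of them can be reached approximately and simultaneously from any neighbourhood of `y`. -/
lemma exists_jointly_reachable [CompactSpace X] {C : Set X} {y : X}
    (hy : closure (MulAction.orbit G y) = C)
    (hap : C ⊆ closure {z : X | z ∈ C ∧ IsAlmostPeriodic G z})
    {M : ℕ → Set X} (hMC : ∀ n, M n ⊆ C) (hM : ∀ n, IsMinimalSubset G (M n)) :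
    ∃ m : ℕ → X, (∀ n, m n ∈ M n) ∧
      ∀ {ι : Type*} [Finite ι] (e : ι → ℕ) (U : Set X) (V : ι → Set X), U ∈ 𝓝 y →
        (∀ i, V i ∈ 𝓝 (m (e i))) → ∃ (w : ι → X) (g : G), ∀ i, w i ∈ U ∧ g • w i ∈ V i := by
  have hpos : ∀ n : ℕ, (0 : ℝ) < 1 / ((n : ℝ) + 1) := fun n => Nat.one_div_pos_of_nat
  have key : ∀ n : ℕ, ∃ (a w : ℕ → X) (g : G), (∀ i, a i ∈ M i) ∧
      ∀ i < n, dist (w i) y < 1 / ((n : ℝ) + 1) ∧ dist (g • w i) (a i) < 1 / ((n : ℝ) + 1) := by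
    intro n
    obtain ⟨S, w, hw, hS⟩ :=
      exists_jointly_syndetic hy hap hMC hM (ball_mem_nhds y (hpos n)) (hpos n) n
    obtain ⟨s, -, hs⟩ := hS 1
    have : ∀ i, ∃ a ∈ M i, i < n → dist ((s * 1) • w i) a < 1 / ((n : ℝ) + 1) := by
      intro i
      by_cases hi : i < n
      · obtain ⟨a, ha, had⟩ := mem_thickening_iff.1 (hs i hi)
        exact ⟨a, ha, fun _ => had⟩
      · obtain ⟨a, ha⟩ := (hM i).1
        exact ⟨a, ha, fun h => absurd h hi⟩
    choose a ha had using this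
    exact ⟨a, w, s * 1, ha, fun i hi => ⟨hw i hi, had i hi⟩⟩
  choose a w g ha hwg using key
  obtain ⟨m, hm, φ, hφ, hlim⟩ :=
    (isCompact_univ_pi fun n => (hM n).isClosed.isCompact).tendsto_subseq
      (x := a) (fun n i _ => ha n i)
  refine ⟨m, fun n => hm n (mem_univ n), fun {ι} _ e U V hU hV => ?_⟩
  have hzero : Tendsto (fun n => 1 / ((φ n : ℝ) + 1)) atTop (𝓝 0) :=
    tendsto_one_div_add_atTop_nhds_zero_nat.comp hφ.tendsto_atTop
  have hev : ∀ i, ∀ᶠ n in atTop, w (φ n) (e i) ∈ U ∧ g (φ n) • w (φ n) (e i) ∈ V i := by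
    intro i
    have hlarge : ∀ᶠ n in atTop, e i < φ n := hφ.tendsto_atTop.eventually_gt_atTop (e i)
    have hlim_i : Tendsto (fun n => a (φ n) (e i)) atTop (𝓝 (m (e i))) :=
      (tendsto_pi_nhds.1 hlim) (e i)
    have h1 : Tendsto (fun n => w (φ n) (e i)) atTop (𝓝 y) := by
      rw [tendsto_iff_dist_tendsto_zero]
      refine squeeze_zero' (Eventually.of_forall fun _ => dist_nonneg) ?_ hzero
      filter_upwards [hlarge] with n hn
      exact (hwg (φ n) (e i) hn).1.le
    have h2 : Tendsto (fun n => g (φ n) • w (φ n) (e i)) atTop (𝓝 (m (e i))) := by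
      refine (tendsto_iff_of_dist ?_).2 hlim_i
      refine squeeze_zero' (Eventually.of_forall fun _ => dist_nonneg) ?_ hzero
      filter_upwards [hlarge] with n hn
      exact (hwg (φ n) (e i) hn).2.le
    exact (h1.eventually_mem hU).and (h2.eventually_mem (hV i))
  obtain ⟨n, hn⟩ := (eventually_all.2 hev).exists
  exact ⟨fun i => w (φ n) (e i), g (φ n), hn⟩

end Joint

end MinimalCenter

theorem theorem1p6 {G : Type*} [CommGroup G] [Infinite G]
    {X : Type*} [MetricSpace X] [CompactSpace X] [MulAction G X] [ContinuousConstSMul G X]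
    {D : Type*} [Preorder D] [IsDirectedOrder D] [Nonempty D]
    (F : D → Finset G) (hF : MinimalCenter.IsFolnerNet F)
    (x : X) (C : Set X) (hC : MinimalCenter.IsMinimalCenter F x C)
    (hgen : MinimalCenter.IsSGeneric F C)
    (hmin : ¬ MinimalCenter.IsMinimalSubset G C)
    (hap : C ⊆ closure {z : X | z ∈ C ∧ MinimalCenter.IsAlmostPeriodic G z}) :
    ∃ K : Set X, K ⊆ C ∧ K.Infinite ∧ K.Countable ∧
      ∀ k : ℕ, 2 ≤ k → ∀ p : Fin k → X, Function.Injective p → (∀ i, p i ∈ K) →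
        ∀ x' ∈ C, ∀ U ∈ 𝓝 x', ∀ V : Fin k → Set X, (∀ i, V i ∈ 𝓝 (p i)) →
          ∃ (y : Fin k → X) (g : G), ∀ i, y i ∈ U ∧ g • y i ∈ V i := by
  obtain ⟨y, hyC, hyF⟩ := hgen
  have hy := hyF.closure_orbit_eq hF hyC
  have hinf := MinimalCenter.infinite_minimalSubsets hy hmin hap
  let M : ℕ → Set X := fun n => hinf.natEmbedding _ n
  have hM : ∀ n, M n ⊆ C ∧ MinimalCenter.IsMinimalSubset G (M n) := fun n =>
    (hinf.natEmbedding _ n).2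
  have hMinj : Function.Injective M :=
    Subtype.val_injective.comp (hinf.natEmbedding _).injective
  obtain ⟨m, hmM, hm⟩ := MinimalCenter.exists_jointly_reachable hy hap
    (fun n => (hM n).1) (fun n => (hM n).2)
  have hminj : Function.Injective m := by
    intro i j hij
    apply hMinj
    rw [← (hM i).2.2 _ (hmM i), hij, (hM j).2.2 _ (hmM j)]
  refine ⟨Set.range m, ?_, Set.infinite_range_of_injective hminj, Set.countable_range m, ?_⟩
  · rintro _ ⟨n, rfl⟩
    exact (hM n).1 (hmM n)
  intro k _ p _ hp x' hx' U hU V hV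
  choose e he using hp
  rw [← hy] at hx'
  -- Some translate `h⁻¹ U` is a neighbourhood of `y`, so only neighbourhoods of `y` matter.
  obtain ⟨_, hhU, h, rfl⟩ := mem_closure_iff_nhds.1 hx' _ (interior_mem_nhds.2 hU)
  have hU' : (fun v : X => h • v) ⁻¹' interior U ∈ 𝓝 y :=
    (isOpen_interior.preimage (continuous_const_smul h)).mem_nhds hhU
  obtain ⟨w, g, hw⟩ := hm e _ V hU' fun i => (he i).symm ▸ hV i
  refine ⟨fun i => h • w i, g * h⁻¹, fun i => ⟨interior_subset (hw i).1, ?_⟩⟩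
  simpa [mul_smul] using (hw i).2
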